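/- Let $0<\alpha\le 1$ and let $E_\alpha(z)=\sum_{n=0}^\infty \frac{z^n}{\Gamma(\alpha n+1)}$, $z\in\mathbb{C}$ (an everywhere convergent series), be the Mittag-Leffler function. Define the measure $\nu_\alpha$ on $[0,\infty)$ as follows. If $0<\alpha<1$, put $$d\nu_\alpha(\tau)=\alpha^{-1}\,\tau^{-1-1/\alpha}\,f_\alpha(\tau^{-1/\alpha})\,d\tau ,\qquad \tau>0,$$ where $f_\alpha\ge 0$ is the one-sided $\alpha$-stable probability density on $(0,\infty)$, that is, the density determined by $\int_0^\infty e^{-t\tau}f_\alpha(\tau)\,d\tau=e^{-t^\alpha}$ for all $t\ge 0$. If $\alpha=1$, let $\nu_1=\delta_1$ be the unit point mass at $1$. Then $\nu_\alpha$ is well defined (for $0<\alpha<1$ a density $f_\alpha$ as above exists, and $\nu_\alpha$ does not depend on the version of $f_\alpha$ chosen), $\nu_\alpha$ is a probability measure on $[0,\infty)$, and for every $z\in\mathbb{C}$ with $\operatorname{Re}(z)\ge 0$ the function $\tau\mapsto e^{-z\tau}$ is $\nu_\alpha$-integrable and $$E_\alpha(-z)=\int_0^\infty e^{-z\tau}\,d\nu_\alpha(\tau).$$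 -/

import Mathlib

open MeasureTheory

noncomputable section

/-- The Mittag-Leffler function `E_α(z) = ∑ zⁿ / Γ(α n + 1)` of a complex argument. -/
def mittagLeffler (α : ℝ) (z : ℂ) : ℂ :=
  ∑' n : ℕ, z ^ n / (Real.Gamma (α * n + 1) : ℂ)

/-- `f` is (a version of) the one-sided `α`-stable probability density: a nonnegative measurable
function on `(0, ∞)` whose Laplace transform is `exp (-t ^ α)`. Taking `t = 0` gives total mass
`1`. The values of `f` outside `(0, ∞)` are irrelevant. -/
structure IsOneSidedStableDensity (α : ℝ) (f : ℝ → ℝ) : Prop where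
  measurable : Measurable f
  nonneg : ∀ x : ℝ, 0 < x → 0 ≤ f x
  laplace : ∀ t : ℝ, 0 ≤ t →
    IntegrableOn (fun τ : ℝ => Real.exp (-t * τ) * f τ) (Set.Ioi 0) ∧
      ∫ τ in Set.Ioi (0 : ℝ), Real.exp (-t * τ) * f τ = Real.exp (-t ^ α)

/-- The measure `α⁻¹ τ ^ (-1 - 1/α) f (τ ^ (-1/α)) dτ` on `(0, ∞)`; it is `ν_α` when `f` is the
one-sided `α`-stable density and `0 < α < 1`. -/
def stableNu (α : ℝ) (f : ℝ → ℝ) : Measure ℝ :=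
  (volume.restrict (Set.Ioi (0 : ℝ))).withDensity fun τ =>
    ENNReal.ofReal (α⁻¹ * τ ^ (-1 - 1 / α) * f (τ ^ (-1 / α)))

/-- `ν` is a version of the measure `ν_α`, `0 < α ≤ 1`. For `α < 1` it is built from the
one-sided `α`-stable density. For `α = 1` the one-sided stable law, with Laplace transform
`exp (-t)`, is the unit mass at `1` and has no density, and `ν_1` is that unit mass. -/
def IsMittagLefflerMeasure (α : ℝ) (ν : Measure ℝ) : Prop :=
  (α < 1 ∧ ∃ f : ℝ → ℝ, IsOneSidedStableDensity α f ∧ ν = stableNu α f) ∨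
    (α = 1 ∧ ν = Measure.dirac 1)

end

/-! The crux is that `ν_α` has moments `n! / Γ(α n + 1)`. If `X` has density `f`, then `ν_α` is the
law of `X ^ (-α)`, and integrating `exp (-t ^ α)` against `t ^ (s - 1)` gives the negative moments
of `X` (`lintegral_rpow_neg`, taken at `s = α n`). Expanding `exp (-z τ)` and integrating term by
term then yields the Mittag-Leffler series (`mittagLeffler_neg_eq_integral`). On the imaginary axis
this computes the characteristic function, so `ν_α` does not depend on the version of `f`.

For `α < 1` the density must also be shown to exist. A stable limit theorem for Pareto variables
gives a law with Laplace transform `exp (-t ^ α)` (`isPowerMoment_exp_neg_rpow`). Differentiating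
the transform gives `α s ^ (α - 1) exp (-s ^ α)`, where `s ^ (α - 1)` is itself, up to a constant,
the transform of `x ^ (-α)`. Hence `x ν(dx)` is a convolution with `x ^ (-α)`, which is absolutely
continuous. -/

/-! ### Laplace transforms as power moments on `[0, 1]` -/

/-- `φ t = ∫ u ^ t dμ(u)`, `t > 0`, for a probability measure `μ` on `[0, 1]`; equivalently `φ` is
the Laplace transform of a (possibly defective) law on `[0, ∞)`. -/
def IsPowerMoment (φ : ℝ → ℝ) : Prop :=
  ∃ μ : ProbabilityMeasure unitInterval, ∀ t : ℝ, 0 < t →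
    ∫ u : unitInterval, (u : ℝ) ^ t ∂(μ : Measure unitInterval) = φ t

namespace IsPowerMoment

theorem one : IsPowerMoment fun _ => 1 :=
  ⟨⟨Measure.dirac 1, inferInstance⟩, fun t _ => by simp⟩

theorem mul {φ ψ : ℝ → ℝ} (hφ : IsPowerMoment φ) (hψ : IsPowerMoment ψ) :
    IsPowerMoment fun t => φ t * ψ t := by
  obtain ⟨μ, hμ⟩ := hφ
  obtain ⟨ν, hν⟩ := hψ
  have hm : Measurable fun p : unitInterval × unitInterval => p.1 * p.2 :=
    (continuous_fst.mul continuous_snd).measurable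
  refine ⟨⟨((μ : Measure unitInterval).prod (ν : Measure unitInterval)).map
    (fun p => p.1 * p.2), Measure.isProbabilityMeasure_map hm.aemeasurable⟩, fun t ht => ?_⟩
  have hc : Continuous fun u : unitInterval => (u : ℝ) ^ t :=
    continuous_subtype_val.rpow_const fun _ => Or.inr ht.le
  simp only [ProbabilityMeasure.coe_mk]
  rw [integral_map hm.aemeasurable hc.aestronglyMeasurable, ← hμ t ht, ← hν t ht,
    ← integral_prod_mul]
  refine integral_congr_ae (ae_of_all _ fun p => ?_)
  exact Real.mul_rpow p.1.2.1 p.2.2.1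

theorem pow {φ : ℝ → ℝ} (hφ : IsPowerMoment φ) (n : ℕ) : IsPowerMoment fun t => φ t ^ n := by
  induction n with
  | zero => simpa using one
  | succ n ih => simpa only [pow_succ] using ih.mul hφ

theorem comp_mul_left {φ : ℝ → ℝ} (hφ : IsPowerMoment φ) {a : ℝ} (ha : 0 < a) :
    IsPowerMoment fun t => φ (a * t) := by
  obtain ⟨μ, hμ⟩ := hφ
  let g : unitInterval → unitInterval := fun u =>
    ⟨(u : ℝ) ^ a, Real.rpow_nonneg u.2.1 a, Real.rpow_le_one u.2.1 u.2.2 ha.le⟩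
  have hg : Measurable g :=
    ((continuous_subtype_val.rpow_const fun _ => Or.inr ha.le).subtype_mk _).measurable
  refine ⟨⟨(μ : Measure unitInterval).map g, Measure.isProbabilityMeasure_map hg.aemeasurable⟩,
    fun t ht => ?_⟩
  have hc : Continuous fun u : unitInterval => (u : ℝ) ^ t :=
    continuous_subtype_val.rpow_const fun _ => Or.inr ht.le
  simp only [ProbabilityMeasure.coe_mk]
  rw [integral_map hg.aemeasurable hc.aestronglyMeasurable, ← hμ _ (mul_pos ha ht)]
  refine integral_congr_ae (ae_of_all _ fun u => ?_)
  exact (Real.rpow_mul u.2.1 a t).symm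

/-- Probability measures on `[0, 1]` form a compact space, so the measures converge weakly along an
ultrafilter. For `t > 0` the function `u ^ t` is continuous up to `u = 0`, where mass escaping to
infinity would collect. -/
theorem of_tendsto {φ : ℕ → ℝ → ℝ} {ψ : ℝ → ℝ} (hφ : ∀ n, IsPowerMoment (φ n))
    (h : ∀ t, 0 < t → Filter.Tendsto (fun n => φ n t) Filter.atTop (nhds (ψ t))) :
    IsPowerMoment ψ := by
  choose μ hμ using hφ
  obtain ⟨ν, -, hν⟩ := isCompact_univ.ultrafilter_le_nhds
    ((Filter.hyperfilter ℕ : Ultrafilter ℕ).map μ) (by simp)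
  refine ⟨ν, fun t ht => ?_⟩
  have hc : Continuous fun u : unitInterval => (u : ℝ) ^ t :=
    continuous_subtype_val.rpow_const fun _ => Or.inr ht.le
  have hlim : Filter.Tendsto μ (Filter.hyperfilter ℕ) (nhds ν) := hν
  rw [ProbabilityMeasure.tendsto_iff_forall_integral_tendsto] at hlim
  have h1 := hlim (BoundedContinuousFunction.mkOfCompact ⟨_, hc⟩)
  simp only [BoundedContinuousFunction.mkOfCompact_apply, ContinuousMap.coe_mk, hμ _ t ht] at h1
  have h2 := (h t ht).mono_left (Nat.hyperfilter_le_atTop)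
  exact tendsto_nhds_unique h1 h2

end IsPowerMoment

/-! ### Stable limit of Pareto sums -/

/-- The law of `exp (-V ^ (-b))` for a uniform `V`. -/
theorem isPowerMoment_integral_exp_neg_rpow {b : ℝ} :
    IsPowerMoment fun t => ∫ v in (0 : ℝ)..1, Real.exp (-t * v ^ (-b)) := by
  let g : unitInterval → unitInterval := fun v =>
    ⟨Real.exp (-(v : ℝ) ^ (-b)), (Real.exp_pos _).le,
      Real.exp_le_one_iff.2 (neg_nonpos.2 (Real.rpow_nonneg v.2.1 _))⟩
  have hg : Measurable g := Measurable.subtype_mk (by fun_prop)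
  refine ⟨⟨(volume : Measure unitInterval).map g, Measure.isProbabilityMeasure_map hg.aemeasurable⟩,
    fun t ht => ?_⟩
  have hc : Continuous fun u : unitInterval => (u : ℝ) ^ t :=
    continuous_subtype_val.rpow_const fun _ => Or.inr ht.le
  simp only [ProbabilityMeasure.coe_mk]
  rw [integral_map hg.aemeasurable hc.aestronglyMeasurable,
    intervalIntegral.integral_of_le zero_le_one, ← integral_Icc_eq_integral_Ioc,
    ← integral_subtype measurableSet_Icc]
  refine integral_congr_ae (ae_of_all _ fun v => ?_)
  simp only [g]
  rw [← Real.exp_mul]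
  ring_nf

theorem integrableOn_one_sub_exp_neg_rpow {b t : ℝ} (hb : 1 < b) (ht : 0 < t) :
    IntegrableOn (fun w : ℝ => 1 - Real.exp (-t * w ^ (-b))) (Set.Ioi 0) := by
  have hmeas : Measurable fun w : ℝ => 1 - Real.exp (-t * w ^ (-b)) := by fun_prop
  rw [← Set.Ioc_union_Ioi_eq_Ioi zero_le_one]
  refine IntegrableOn.union ?_ ?_
  · refine Measure.integrableOn_of_bounded (M := 1) (by simp) hmeas.aestronglyMeasurable ?_
    filter_upwards [ae_restrict_mem measurableSet_Ioc] with w hw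
    have h0 : 0 ≤ t * w ^ (-b) := mul_nonneg ht.le (Real.rpow_nonneg hw.1.le _)
    have h1 : Real.exp (-t * w ^ (-b)) ≤ 1 := Real.exp_le_one_iff.2 (by linarith)
    rw [Real.norm_eq_abs, abs_le]
    constructor <;> linarith [Real.exp_pos (-t * w ^ (-b))]
  · refine Integrable.mono' ((integrableOn_Ioi_rpow_of_lt (a := -b) (by linarith)
      zero_lt_one).const_mul t) hmeas.aestronglyMeasurable ?_
    filter_upwards [ae_restrict_mem measurableSet_Ioi] with w hw
    have h0 : 0 ≤ t * w ^ (-b) :=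
      mul_nonneg ht.le (Real.rpow_nonneg (zero_lt_one.trans hw).le _)
    have h1 : Real.exp (-t * w ^ (-b)) ≤ 1 := Real.exp_le_one_iff.2 (by linarith)
    have h2 := Real.add_one_le_exp (-t * w ^ (-b))
    rw [Real.norm_eq_abs, abs_le]
    constructor <;> linarith

theorem integral_one_sub_exp_neg_rpow_pos {b : ℝ} (hb : 1 < b) :
    0 < ∫ w in Set.Ioi (0 : ℝ), (1 - Real.exp (-w ^ (-b))) := by
  have hint : IntegrableOn (fun w : ℝ => 1 - Real.exp (-w ^ (-b))) (Set.Ioi 0) := by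
    simpa using integrableOn_one_sub_exp_neg_rpow hb one_pos
  have hpos : ∀ w ∈ Set.Ioi (0 : ℝ), 0 < 1 - Real.exp (-w ^ (-b)) := fun w hw => by
    have := Real.rpow_pos_of_pos hw (-b)
    exact sub_pos.2 (Real.exp_lt_one_iff.2 (neg_lt_zero.2 this))
  rw [setIntegral_pos_iff_support_of_nonneg_ae _ hint]
  · refine lt_of_lt_of_le ?_ (measure_mono (s := Set.Ioi (0 : ℝ)) fun w hw => ⟨(hpos w hw).ne', hw⟩)
    simp
  · filter_upwards [ae_restrict_mem measurableSet_Ioi] with w hw using (hpos w hw).le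

/-- Rescaling `w` by `t ^ (1 / b)` absorbs `t`; this is where the exponent `α = 1 / b` comes from.
-/
theorem integral_one_sub_exp_neg_mul_rpow {b t : ℝ} (hb : 1 < b) (ht : 0 < t) :
    ∫ w in Set.Ioi (0 : ℝ), (1 - Real.exp (-t * w ^ (-b))) =
      t ^ (1 / b) * ∫ w in Set.Ioi (0 : ℝ), (1 - Real.exp (-w ^ (-b))) := by
  have ha : 0 < t ^ (1 / b) := Real.rpow_pos_of_pos ht _
  have h := integral_comp_mul_left_Ioi (fun w : ℝ => 1 - Real.exp (-t * w ^ (-b))) 0 ha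
  rw [mul_zero, smul_eq_mul] at h
  rw [eq_comm, ← eq_inv_mul_iff_mul_eq₀ ha.ne', ← h]
  refine setIntegral_congr_fun measurableSet_Ioi fun w hw => ?_
  have : t * (t ^ (1 / b) * w) ^ (-b) = w ^ (-b) := by
    rw [Real.mul_rpow ha.le (le_of_lt hw), ← Real.rpow_mul ht.le,
      show 1 / b * -b = -1 by field_simp, Real.rpow_neg_one]
    field_simp
  simp only [neg_mul, this]

/-- `exp (-t ^ α)`, `0 < α < 1`, as a limit of Laplace transforms of rescaled sums of independent
variables with a Pareto tail. -/
theorem isPowerMoment_exp_neg_rpow {α : ℝ} (hα0 : 0 < α) (hα1 : α < 1) :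
    IsPowerMoment fun t => Real.exp (-t ^ α) := by
  set b : ℝ := 1 / α with hbdef
  have hb : 1 < b := by rw [hbdef, lt_div_iff₀ hα0]; linarith
  have hbα : 1 / b = α := by rw [hbdef, one_div_one_div]
  set C := ∫ w in Set.Ioi (0 : ℝ), (1 - Real.exp (-w ^ (-b)))
  have hCpos : 0 < C := integral_one_sub_exp_neg_rpow_pos hb
  have key : IsPowerMoment fun t => Real.exp (-(t ^ α * C)) := by
    refine IsPowerMoment.of_tendsto (φ := fun n t =>
      (∫ v in (0 : ℝ)..1, Real.exp (-((n + 1 : ℕ) ^ (-b) * t) * v ^ (-b))) ^ (n + 1)) ?_ ?_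
    · intro n
      exact (isPowerMoment_integral_exp_neg_rpow.comp_mul_left
        (a := ((n + 1 : ℕ) : ℝ) ^ (-b)) (by positivity)).pow (n + 1)
    · intro t ht
      have hint := integrableOn_one_sub_exp_neg_rpow hb ht
      have hlim := (intervalIntegral_tendsto_integral_Ioi 0 hint
        tendsto_natCast_atTop_atTop).neg
      rw [integral_one_sub_exp_neg_mul_rpow hb ht, hbα] at hlim
      -- The substitution `w = n v` puts the truncated integral in the form `n * (I - 1)` needed for
      -- `(1 + (I - 1)) ^ n` to converge to an exponential.
      have hid : ∀ᶠ n : ℕ in Filter.atTop,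
          -∫ w in (0 : ℝ)..n, (1 - Real.exp (-t * w ^ (-b))) =
          n * ((∫ v in (0 : ℝ)..1, Real.exp (-((n : ℝ) ^ (-b) * t) * v ^ (-b))) - 1) := by
        filter_upwards [Filter.eventually_gt_atTop 0] with n hn
        have hn' : (0 : ℝ) < n := by exact_mod_cast hn
        have h1 := intervalIntegral.integral_comp_mul_left (a := 0) (b := 1)
          (fun w : ℝ => 1 - Real.exp (-t * w ^ (-b))) hn'.ne'
        rw [mul_zero, mul_one, smul_eq_mul, eq_inv_mul_iff_mul_eq₀ hn'.ne'] at h1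
        rw [← h1, ← mul_neg, ← intervalIntegral.integral_neg]
        have h2 : ∫ v in (0 : ℝ)..1, -(1 - Real.exp (-t * (n * v) ^ (-b))) =
            ∫ v in (0 : ℝ)..1, (Real.exp (-((n : ℝ) ^ (-b) * t) * v ^ (-b)) - 1) := by
          refine intervalIntegral.integral_congr fun v hv => ?_
          rw [Set.uIcc_of_le zero_le_one] at hv
          simp only [Real.mul_rpow hn'.le hv.1, neg_sub]
          ring_nf
        have hi : IntervalIntegrable
            (fun v : ℝ => Real.exp (-((n : ℝ) ^ (-b) * t) * v ^ (-b))) volume 0 1 := by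
          rw [intervalIntegrable_iff_integrableOn_Ioc_of_le zero_le_one]
          have := (integrableOn_one_sub_exp_neg_rpow hb
            (t := (n : ℝ) ^ (-b) * t) (by positivity)).mono_set Set.Ioc_subset_Ioi_self
            (s := Set.Ioc 0 1)
          refine ((integrable_const (1 : ℝ)).sub this).congr (ae_of_all _ fun v => ?_)
          simp
        rw [h2, intervalIntegral.integral_sub hi intervalIntegrable_const]
        simp
      have h3 := Real.tendsto_one_add_pow_exp_of_tendsto (hlim.congr' hid)
      simp only [add_sub_cancel] at h3
      exact (Filter.tendsto_add_atTop_iff_nat 1).2 h3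
  -- Since `b * α = 1`, rescaling `t` by `C ^ (-b)` cancels the constant `C`.
  have hr := key.comp_mul_left (a := C ^ (-b)) (by positivity)
  obtain ⟨μ, hμ⟩ := hr
  refine ⟨μ, fun t ht => ?_⟩
  rw [hμ t ht]
  simp only
  rw [Real.mul_rpow (by positivity) ht.le, ← Real.rpow_mul hCpos.le,
    show -b * α = -1 by rw [hbdef]; field_simp, Real.rpow_neg_one]
  field_simp

/-- Transport by `y = -log u`. A possible atom at `u = 0` is discarded: it contributes `0 ^ t = 0`
for `t > 0`. -/
theorem exists_measure_laplace_eq_exp_neg_rpow {α : ℝ} (hα0 : 0 < α) (hα1 : α < 1) :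
    ∃ ν : Measure ℝ, IsFiniteMeasure ν ∧ (∀ᵐ y ∂ν, 0 ≤ y) ∧ ∀ t : ℝ, 0 < t →
      ∫⁻ y, ENNReal.ofReal (Real.exp (-(t * y))) ∂ν = ENNReal.ofReal (Real.exp (-t ^ α)) := by
  obtain ⟨μ, hμ⟩ := isPowerMoment_exp_neg_rpow hα0 hα1
  simp only at hμ
  have hS : MeasurableSet {u : unitInterval | 0 < (u : ℝ)} :=
    measurableSet_lt measurable_const measurable_subtype_coe
  have hg : Measurable fun u : unitInterval => -Real.log (u : ℝ) := by fun_prop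
  refine ⟨((μ : Measure unitInterval).restrict {u | 0 < (u : ℝ)}).map
    (fun u : unitInterval => -Real.log (u : ℝ)), Measure.isFiniteMeasure_map _ _, ?_, fun t ht => ?_⟩
  · rw [ae_map_iff hg.aemeasurable measurableSet_Ici]
    exact ae_of_all _ fun u => neg_nonneg.2 (Real.log_nonpos u.2.1 u.2.2)
  · have hc : Continuous fun u : unitInterval => (u : ℝ) ^ t :=
      continuous_subtype_val.rpow_const fun _ => Or.inr ht.le
    have hint : Integrable (fun u : unitInterval => (u : ℝ) ^ t) (μ : Measure unitInterval) :=
      hc.integrable_of_hasCompactSupport (HasCompactSupport.of_compactSpace _)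
    rw [lintegral_map (by fun_prop) hg, ← hμ t ht,
      ofReal_integral_eq_lintegral_ofReal hint (ae_of_all _ fun u => Real.rpow_nonneg u.2.1 t),
      ← setLIntegral_eq_of_support_subset (s := {u : unitInterval | 0 < (u : ℝ)})
        (f := fun u : unitInterval => ENNReal.ofReal ((u : ℝ) ^ t))]
    · refine setLIntegral_congr_fun hS fun u hu => ?_
      rw [Real.rpow_def_of_pos hu]
      ring_nf
    · intro u hu
      refine lt_of_le_of_ne u.2.1 fun h => hu ?_
      simp only [← h, Real.zero_rpow ht.ne', ENNReal.ofReal_zero]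

/-! ### Density of the stable law -/

theorem lintegral_rpow_mul_exp_neg_mul_Ioi {a r : ℝ} (ha : 0 < a) (hr : 0 < r) :
    ∫⁻ t in Set.Ioi (0 : ℝ), ENNReal.ofReal (t ^ (a - 1) * Real.exp (-(r * t))) =
      ENNReal.ofReal (r ^ (-a) * Real.Gamma a) := by
  have h := Real.integral_rpow_mul_exp_neg_mul_Ioi ha hr
  have hΓ := Real.Gamma_pos_of_pos ha
  rw [one_div, Real.inv_rpow hr.le, ← Real.rpow_neg hr.le] at h
  rw [← h, ofReal_integral_eq_lintegral_ofReal]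
  · exact Integrable.of_integral_ne_zero (by rw [h]; positivity)
  · filter_upwards [ae_restrict_mem measurableSet_Ioi] with t ht
    exact mul_nonneg (Real.rpow_nonneg (le_of_lt ht) _) (Real.exp_pos _).le

theorem lintegral_exp_neg_mul_Ioi {x : ℝ} (hx : 0 < x) (t : ℝ) :
    ∫⁻ s in Set.Ioi t, ENNReal.ofReal (Real.exp (-(s * x))) =
      ENNReal.ofReal (Real.exp (-(t * x)) / x) := by
  have h := integral_exp_mul_Ioi (neg_lt_zero.2 hx) t
  rw [neg_div_neg_eq] at h
  have e : ∀ s : ℝ, -(s * x) = -x * s := fun s => by ring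
  simp only [e]
  rw [← h, ofReal_integral_eq_lintegral_ofReal (integrableOn_exp_mul_Ioi (neg_lt_zero.2 hx) t)
    (ae_of_all _ fun s => (Real.exp_pos _).le)]

theorem lintegral_deriv_exp_neg_rpow_Ioi {α t : ℝ} (hα0 : 0 < α) (ht : 0 ≤ t) :
    ∫⁻ s in Set.Ioi t, ENNReal.ofReal (α * s ^ (α - 1) * Real.exp (-s ^ α)) =
      ENNReal.ofReal (Real.exp (-t ^ α)) := by
  have hc : ContinuousWithinAt (fun s : ℝ => -Real.exp (-s ^ α)) (Set.Ici t) t :=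
    ((Real.continuous_exp.comp (Real.continuous_rpow_const hα0.le).neg).neg).continuousWithinAt
  have hd : ∀ s ∈ Set.Ioi t, HasDerivAt (fun s : ℝ => -Real.exp (-s ^ α))
      (α * s ^ (α - 1) * Real.exp (-s ^ α)) s := fun s hs => by
    have h := ((Real.hasDerivAt_rpow_const (p := α)
      (Or.inl (ht.trans_lt hs).ne')).neg.exp).neg
    refine h.congr_deriv ?_
    simp only [Pi.neg_apply]
    ring
  have hn : ∀ s ∈ Set.Ioi t, 0 ≤ α * s ^ (α - 1) * Real.exp (-s ^ α) := fun s hs => by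
    have : 0 < s := ht.trans_lt hs
    positivity
  have hl : Filter.Tendsto (fun s : ℝ => -Real.exp (-s ^ α)) Filter.atTop (nhds 0) := by
    rw [← neg_zero]
    exact (Real.tendsto_exp_neg_atTop_nhds_zero.comp (tendsto_rpow_atTop hα0)).neg
  have h := integral_Ioi_of_hasDerivAt_of_nonneg hc hd hn hl
  rw [zero_sub, neg_neg] at h
  rw [← h, ofReal_integral_eq_lintegral_ofReal (integrableOn_Ioi_deriv_of_nonneg hc hd hn hl)]
  filter_upwards [ae_restrict_mem measurableSet_Ioi] with s hs using hn s hs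

/-- The kernel `x ↦ x ^ (-α)` on `(0, ∞)`, extended by zero. -/
noncomputable def rpowNegKernel (α : ℝ) : ℝ → ENNReal :=
  (Set.Ioi (0 : ℝ)).indicator fun x => ENNReal.ofReal (x ^ (-α))

theorem measurable_rpowNegKernel (α : ℝ) : Measurable (rpowNegKernel α) :=
  Measurable.indicator (by fun_prop) measurableSet_Ioi

theorem lintegral_exp_mul_rpowNegKernel_sub {α s y : ℝ} (hα1 : α < 1) (hs : 0 < s) (hy : 0 ≤ y) :
    ∫⁻ x in Set.Ioi (0 : ℝ), ENNReal.ofReal (Real.exp (-(s * x))) * rpowNegKernel α (x - y) =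
      ENNReal.ofReal (s ^ (α - 1) * Real.Gamma (1 - α)) *
        ENNReal.ofReal (Real.exp (-(s * y))) := by
  rw [setLIntegral_eq_of_support_subset, ← lintegral_add_right_eq_self _ y]
  · simp only [add_sub_cancel_right]
    have h := lintegral_rpow_mul_exp_neg_mul_Ioi (a := 1 - α) (by linarith) hs
    rw [neg_sub] at h
    rw [← h, mul_comm, ← lintegral_const_mul _ (by fun_prop), ← lintegral_indicator
      measurableSet_Ioi]
    refine lintegral_congr fun x => ?_
    by_cases hx : x ∈ Set.Ioi (0 : ℝ)
    · rw [rpowNegKernel, Set.indicator_of_mem hx, Set.indicator_of_mem hx,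
        ← ENNReal.ofReal_mul (Real.exp_pos _).le, ← ENNReal.ofReal_mul (Real.exp_pos _).le,
        mul_add, neg_add, Real.exp_add, show 1 - α - 1 = -α by ring]
      ring_nf
    · rw [rpowNegKernel, Set.indicator_of_notMem hx, Set.indicator_of_notMem hx, mul_zero]
  · intro x hx
    by_contra h
    refine hx ?_
    have : x - y ∉ Set.Ioi (0 : ℝ) := fun h' => h (by
      simp only [Set.mem_Ioi] at h' ⊢; linarith)
    simp only [rpowNegKernel, Set.indicator_of_notMem this, mul_zero]

theorem lintegral_exp_mul_conv_rpowNegKernel {α s : ℝ} (hα1 : α < 1) {ν : Measure ℝ}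
    [IsFiniteMeasure ν] (hν : ∀ᵐ y ∂ν, 0 ≤ y) (hs : 0 < s) :
    ∫⁻ x in Set.Ioi (0 : ℝ), ENNReal.ofReal (Real.exp (-(s * x))) *
        ∫⁻ y, rpowNegKernel α (x - y) ∂ν =
      ENNReal.ofReal (s ^ (α - 1) * Real.Gamma (1 - α)) *
        ∫⁻ y, ENNReal.ofReal (Real.exp (-(s * y))) ∂ν := by
  have hk := measurable_rpowNegKernel α
  have h1 : ∀ x : ℝ, ENNReal.ofReal (Real.exp (-(s * x))) * ∫⁻ y, rpowNegKernel α (x - y) ∂ν =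
      ∫⁻ y, ENNReal.ofReal (Real.exp (-(s * x))) * rpowNegKernel α (x - y) ∂ν := fun x =>
    (lintegral_const_mul _ (by fun_prop)).symm
  simp only [h1]
  rw [lintegral_lintegral_swap, ← lintegral_const_mul _ (by fun_prop)]
  · refine lintegral_congr_ae ?_
    filter_upwards [hν] with y hy using lintegral_exp_mul_rpowNegKernel_sub hα1 hs hy
  · refine Measurable.aemeasurable ?_
    unfold Function.uncurry
    fun_prop

/-- A measure `ν` on `[0, ∞)` with Laplace transform `exp (-t ^ α)` satisfies
`x ν(dx) = α / Γ(1 - α) (x ^ (-α) * ν)(x) dx`, which yields the density. -/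
theorem exists_isOneSidedStableDensity {α : ℝ} (hα0 : 0 < α) (hα1 : α < 1) :
    ∃ f : ℝ → ℝ, IsOneSidedStableDensity α f := by
  obtain ⟨ν, hfin, hν, hlap⟩ := exists_measure_laplace_eq_exp_neg_rpow hα0 hα1
  have hΓ : 0 < Real.Gamma (1 - α) := Real.Gamma_pos_of_pos (by linarith)
  have hk := measurable_rpowNegKernel α
  have hK : Measurable fun x : ℝ => ∫⁻ y, rpowNegKernel α (x - y) ∂ν :=
    Measurable.lintegral_prod_right' (f := fun p : ℝ × ℝ => rpowNegKernel α (p.1 - p.2))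
      (by fun_prop)
  set c := ENNReal.ofReal (α / Real.Gamma (1 - α)) with hcdef
  let h : ℝ → ENNReal := fun x =>
    ENNReal.ofReal x⁻¹ * (c * ∫⁻ y, rpowNegKernel α (x - y) ∂ν)
  have hh : Measurable h := by fun_prop
  have hL : ∀ t : ℝ, 0 ≤ t → ∫⁻ x in Set.Ioi (0 : ℝ), ENNReal.ofReal (Real.exp (-(t * x))) * h x =
      ENNReal.ofReal (Real.exp (-t ^ α)) := by
    intro t ht
    -- The factor `x⁻¹` is produced by integrating `exp (-s x)` over `s > t`, which undoes the
    -- differentiation of the transform.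
    have h1 : ∀ x ∈ Set.Ioi (0 : ℝ), ENNReal.ofReal (Real.exp (-(t * x))) * h x =
        ∫⁻ s in Set.Ioi t, ENNReal.ofReal (Real.exp (-(s * x))) *
          (c * ∫⁻ y, rpowNegKernel α (x - y) ∂ν) := fun x hx => by
      rw [lintegral_mul_const _ (by fun_prop), lintegral_exp_neg_mul_Ioi hx, div_eq_mul_inv,
        ENNReal.ofReal_mul (Real.exp_pos _).le, mul_assoc]
    rw [setLIntegral_congr_fun measurableSet_Ioi h1, lintegral_lintegral_swap,
      ← lintegral_deriv_exp_neg_rpow_Ioi hα0 ht]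
    · refine setLIntegral_congr_fun measurableSet_Ioi fun s hs => ?_
      have hs0 : 0 < s := ht.trans_lt hs
      have h2 := lintegral_exp_mul_conv_rpowNegKernel hα1 hν hs0
      simp only [mul_left_comm _ c]
      rw [lintegral_const_mul _ (by fun_prop), h2, hlap s hs0, hcdef, ← mul_assoc,
        ← ENNReal.ofReal_mul (by positivity), ← ENNReal.ofReal_mul (by positivity)]
      congr 1
      field_simp
    · refine Measurable.aemeasurable ?_
      unfold Function.uncurry
      fun_prop
  have hfinite : ∀ᵐ x ∂volume.restrict (Set.Ioi (0 : ℝ)), h x < ⊤ := by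
    refine ae_lt_top hh ?_
    have := hL 0 le_rfl
    simp only [zero_mul, neg_zero, Real.exp_zero, ENNReal.ofReal_one, one_mul] at this
    rw [this]
    exact ENNReal.ofReal_ne_top
  refine ⟨fun x => (h x).toReal, hh.ennreal_toReal, fun _ _ => ENNReal.toReal_nonneg,
    fun t ht => ?_⟩
  have hnn : ∀ x : ℝ, 0 ≤ Real.exp (-t * x) * (h x).toReal := fun x =>
    mul_nonneg (Real.exp_pos _).le ENNReal.toReal_nonneg
  have hmeas : AEStronglyMeasurable (fun x : ℝ => Real.exp (-t * x) * (h x).toReal)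
      (volume.restrict (Set.Ioi 0)) := by
    have := hh.ennreal_toReal
    exact Measurable.aestronglyMeasurable (by fun_prop)
  have hLr : ∫⁻ x in Set.Ioi (0 : ℝ), ENNReal.ofReal (Real.exp (-t * x) * (h x).toReal) =
      ENNReal.ofReal (Real.exp (-t ^ α)) := by
    rw [← hL t ht]
    refine lintegral_congr_ae ?_
    filter_upwards [hfinite] with x hx
    rw [ENNReal.ofReal_mul (Real.exp_pos _).le, ENNReal.ofReal_toReal hx.ne, neg_mul]
  refine ⟨⟨hmeas, ?_⟩, ?_⟩
  · rw [hasFiniteIntegral_iff_ofReal (ae_of_all _ hnn), hLr]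
    exact ENNReal.ofReal_lt_top
  · rw [integral_eq_lintegral_of_nonneg_ae (ae_of_all _ hnn) hmeas, hLr,
      ENNReal.toReal_ofReal (Real.exp_pos _).le]

/-! ### Moments of `ν_α` -/

theorem lintegral_comp_rpow_Ioi {p : ℝ} (hp : p ≠ 0) (g : ℝ → ENNReal) :
    ∫⁻ x in Set.Ioi (0 : ℝ), ENNReal.ofReal (|p| * x ^ (p - 1)) * g (x ^ p) =
      ∫⁻ y in Set.Ioi (0 : ℝ), g y := by
  have a : (fun x : ℝ => x ^ p) '' Set.Ioi 0 = Set.Ioi (0 : ℝ) := by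
    ext x
    constructor
    · rintro ⟨y, hy, rfl⟩
      exact Real.rpow_pos_of_pos hy p
    · exact fun hx => ⟨x ^ (1 / p), Real.rpow_pos_of_pos hx _, by
        simp [← Real.rpow_mul (le_of_lt hx), hp]⟩
  have h := lintegral_image_eq_lintegral_abs_deriv_mul measurableSet_Ioi
    (fun x hx => (Real.hasDerivAt_rpow_const (p := p)
      (Or.inl (Set.mem_Ioi.mp hx).ne')).hasDerivWithinAt)
    ((Real.rpow_left_injOn hp).mono Set.Ioi_subset_Ici_self) g
  rw [a] at h
  rw [h]
  refine setLIntegral_congr_fun measurableSet_Ioi fun x hx => ?_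
  simp only [abs_mul, abs_of_nonneg (Real.rpow_nonneg (le_of_lt hx) (p - 1))]

theorem lintegral_rpow_mul_exp_neg_rpow {α s : ℝ} (hα0 : 0 < α) (hs : 0 < s) :
    ∫⁻ t in Set.Ioi (0 : ℝ), ENNReal.ofReal (t ^ (s - 1) * Real.exp (-t ^ α)) =
      ENNReal.ofReal (1 / α * Real.Gamma (s / α)) := by
  have h := integral_rpow_mul_exp_neg_rpow (q := s - 1) hα0 (by linarith)
  rw [sub_add_cancel] at h
  have hΓ := Real.Gamma_pos_of_pos (div_pos hs hα0)
  rw [← h, ofReal_integral_eq_lintegral_ofReal]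
  · exact Integrable.of_integral_ne_zero (by rw [h]; positivity)
  · filter_upwards [ae_restrict_mem measurableSet_Ioi] with t ht
    exact mul_nonneg (Real.rpow_nonneg (le_of_lt ht) _) (Real.exp_pos _).le

namespace IsOneSidedStableDensity

variable {α : ℝ} {f : ℝ → ℝ}

theorem lintegral_laplace (hf : IsOneSidedStableDensity α f) {t : ℝ} (ht : 0 ≤ t) :
    ∫⁻ x in Set.Ioi (0 : ℝ), ENNReal.ofReal (Real.exp (-(t * x))) * ENNReal.ofReal (f x) =
      ENNReal.ofReal (Real.exp (-t ^ α)) := by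
  obtain ⟨hi, he⟩ := hf.laplace t ht
  rw [← he, ofReal_integral_eq_lintegral_ofReal hi]
  · refine lintegral_congr fun x => ?_
    rw [ENNReal.ofReal_mul (Real.exp_pos _).le, neg_mul]
  · filter_upwards [ae_restrict_mem measurableSet_Ioi] with x hx
    exact mul_nonneg (Real.exp_pos _).le (hf.nonneg x hx)

/-- Write `Γ(s) x ^ (-s)` as the integral of `t ^ (s - 1) exp (-t x)` over `t > 0` and exchange the
integrals. -/
theorem lintegral_rpow_neg (hf : IsOneSidedStableDensity α f) (hα0 : 0 < α) {s : ℝ} (hs : 0 < s) :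
    ∫⁻ x in Set.Ioi (0 : ℝ), ENNReal.ofReal (x ^ (-s)) * ENNReal.ofReal (f x) =
      ENNReal.ofReal (Real.Gamma (s / α) / (α * Real.Gamma s)) := by
  have hΓ := Real.Gamma_pos_of_pos hs
  have hfm := hf.measurable
  have h1 : ENNReal.ofReal (Real.Gamma s) * ∫⁻ x in Set.Ioi (0 : ℝ),
      ENNReal.ofReal (x ^ (-s)) * ENNReal.ofReal (f x) =
      ∫⁻ x in Set.Ioi (0 : ℝ), ∫⁻ t in Set.Ioi (0 : ℝ), ENNReal.ofReal (t ^ (s - 1)) *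
        (ENNReal.ofReal (Real.exp (-(t * x))) * ENNReal.ofReal (f x)) := by
    rw [← lintegral_const_mul _ (by fun_prop)]
    refine setLIntegral_congr_fun measurableSet_Ioi fun x hx => ?_
    rw [← mul_assoc, ← ENNReal.ofReal_mul hΓ.le, mul_comm (Real.Gamma s),
      ← lintegral_rpow_mul_exp_neg_mul_Ioi hs hx, ← lintegral_mul_const _ (by fun_prop)]
    refine setLIntegral_congr_fun measurableSet_Ioi fun t ht => ?_
    rw [ENNReal.ofReal_mul (Real.rpow_nonneg (le_of_lt ht) _), mul_assoc, mul_comm x t]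
  have h2 : ∫⁻ t in Set.Ioi (0 : ℝ), ∫⁻ x in Set.Ioi (0 : ℝ), ENNReal.ofReal (t ^ (s - 1)) *
        (ENNReal.ofReal (Real.exp (-(t * x))) * ENNReal.ofReal (f x)) =
      ENNReal.ofReal (1 / α * Real.Gamma (s / α)) := by
    rw [← lintegral_rpow_mul_exp_neg_rpow hα0 hs]
    refine setLIntegral_congr_fun measurableSet_Ioi fun t ht => ?_
    rw [lintegral_const_mul _ (by fun_prop), hf.lintegral_laplace (le_of_lt ht),
      ENNReal.ofReal_mul (Real.rpow_nonneg (le_of_lt ht) _)]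
  rw [lintegral_lintegral_swap, h2] at h1
  · have h0 : ENNReal.ofReal (Real.Gamma s) ≠ 0 := (ENNReal.ofReal_pos.2 hΓ).ne'
    rw [← ENNReal.mul_right_inj h0 ENNReal.ofReal_ne_top, h1, ← ENNReal.ofReal_mul hΓ.le]
    congr 1
    field_simp
  · refine Measurable.aemeasurable ?_
    unfold Function.uncurry
    fun_prop

end IsOneSidedStableDensity

theorem lintegral_stableNu {α : ℝ} (hα0 : 0 < α) {f : ℝ → ℝ} (hf : Measurable f)
    {G : ℝ → ENNReal} (hG : Measurable G) :
    ∫⁻ τ, G τ ∂stableNu α f =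
      ∫⁻ x in Set.Ioi (0 : ℝ), G (x ^ (-α)) * ENNReal.ofReal (f x) := by
  rw [stableNu, lintegral_withDensity_eq_lintegral_mul _ (by fun_prop) hG,
    ← lintegral_comp_rpow_Ioi (p := -1 / α) (div_ne_zero (by norm_num) hα0.ne')
      fun x => G (x ^ (-α)) * ENNReal.ofReal (f x)]
  refine setLIntegral_congr_fun measurableSet_Ioi fun τ hτ => ?_
  have hτ' : (0 : ℝ) < τ := hτ
  simp only [Pi.mul_apply]
  rw [← Real.rpow_mul hτ'.le, show -1 / α * -α = 1 by field_simp, Real.rpow_one,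
    ENNReal.ofReal_mul (by positivity), neg_div, abs_neg, abs_of_pos (by positivity), one_div,
    show -α⁻¹ - 1 = -1 - α⁻¹ by ring]
  ring

theorem ae_pos_stableNu (α : ℝ) (f : ℝ → ℝ) : ∀ᵐ τ ∂stableNu α f, 0 < τ :=
  (withDensity_absolutelyContinuous _ _).ae_le (ae_restrict_mem measurableSet_Ioi)

theorem lintegral_pow_stableNu {α : ℝ} (hα0 : 0 < α) {f : ℝ → ℝ}
    (hf : IsOneSidedStableDensity α f) (n : ℕ) :
    ∫⁻ τ, ENNReal.ofReal (τ ^ n) ∂stableNu α f =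
      ENNReal.ofReal (n.factorial / Real.Gamma (α * n + 1)) := by
  rw [lintegral_stableNu hα0 hf.measurable (by fun_prop)]
  -- The negative-moment formula needs `s = α n > 0`; the case `n = 0` is the total mass, read off
  -- at `t = 0`.
  rcases n with _ | n
  · simpa [Real.zero_rpow hα0.ne'] using hf.lintegral_laplace le_rfl
  · have hs : 0 < α * (n + 1 : ℕ) := by positivity
    have hΓ := Real.Gamma_pos_of_pos hs
    have h := hf.lintegral_rpow_neg hα0 hs
    rw [mul_div_cancel_left₀ _ hα0.ne', Nat.cast_succ, Real.Gamma_nat_eq_factorial,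
      ← Nat.cast_succ] at h
    rw [Real.Gamma_add_one hs.ne', Nat.factorial_succ]
    convert h using 1
    · refine setLIntegral_congr_fun measurableSet_Ioi fun x hx => ?_
      rw [← Real.rpow_mul_natCast (le_of_lt hx), neg_mul]
    · congr 1
      push_cast at hΓ ⊢
      field_simp

/-! ### Convergence and termwise integration of the series -/

/-- Only the part of the Gamma integral over `(A, A + 1]` is kept. As `A` is arbitrary, `Γ` outgrows
every geometric sequence. -/
theorem rpow_mul_exp_le_Gamma {A s : ℝ} (hA : 0 < A) (hs : 1 ≤ s) :
    A ^ (s - 1) * Real.exp (-(A + 1)) ≤ Real.Gamma s := by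
  have hs0 : 0 < s := by linarith
  have hsub : Set.Ioc A (A + 1) ⊆ Set.Ioi 0 := fun x hx => hA.trans hx.1
  have hint := Real.GammaIntegral_convergent hs0
  rw [Real.Gamma_eq_integral hs0]
  refine le_trans ?_ (setIntegral_mono_set hint ?_ hsub.eventuallyLE)
  · have h := setIntegral_ge_of_const_le_real (μ := volume)
      (c := A ^ (s - 1) * Real.exp (-(A + 1))) measurableSet_Ioc (by simp) ?_
      (hint.mono_set hsub)
    · simpa using h
    · intro x hx
      rw [mul_comm]
      exact mul_le_mul (Real.exp_le_exp.2 (neg_le_neg hx.2))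
        (Real.rpow_le_rpow hA.le hx.1.le (by linarith)) (Real.rpow_nonneg hA.le _)
        (Real.exp_pos _).le
  · filter_upwards [ae_restrict_mem measurableSet_Ioi] with x hx
    exact mul_nonneg (Real.exp_pos _).le (Real.rpow_nonneg (le_of_lt hx) _)

theorem summable_mittagLeffler {α : ℝ} (hα0 : 0 < α) (z : ℂ) :
    Summable fun n : ℕ => z ^ n / (Real.Gamma (α * n + 1) : ℂ) := by
  set B : ℝ := 2 * ‖z‖ + 1 with hB
  have hB0 : 0 < B := by positivity
  -- Chosen so that `A ^ (α n) = B ^ n`, leaving a geometric majorant of ratio `‖z‖ / B < 1`.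
  set A : ℝ := B ^ (1 / α)
  have hA : 0 < A := by positivity
  have hr : ‖z‖ / B < 1 := by
    rw [div_lt_one hB0]
    linarith [norm_nonneg z]
  refine Summable.of_norm_bounded ((summable_geometric_of_lt_one (by positivity) hr).mul_left
    (Real.exp (A + 1))) fun n => ?_
  have hΓ := rpow_mul_exp_le_Gamma hA (s := α * n + 1) (by nlinarith [n.cast_nonneg (α := ℝ)])
  rw [add_sub_cancel_right, ← Real.rpow_mul hB0.le, ← mul_assoc, one_div_mul_cancel hα0.ne',
    one_mul, Real.rpow_natCast] at hΓ
  have hpos : 0 < B ^ n * Real.exp (-(A + 1)) := by positivity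
  rw [norm_div, norm_pow, Complex.norm_real, Real.norm_of_nonneg (hpos.le.trans hΓ)]
  calc ‖z‖ ^ n / Real.Gamma (α * n + 1) ≤ ‖z‖ ^ n / (B ^ n * Real.exp (-(A + 1))) := by gcongr
    _ = Real.exp (A + 1) * (‖z‖ / B) ^ n := by
      rw [Real.exp_neg, div_pow]
      field_simp

/-- The series of `E_α` integrated term by term against a measure on `[0, ∞)` with moments
`n! / Γ(α n + 1)`. -/
theorem mittagLeffler_neg_eq_integral {α : ℝ} (hα0 : 0 < α) {ν : Measure ℝ}
    (hν : ∀ᵐ τ ∂ν, 0 ≤ τ) (hmom : ∀ n : ℕ, ∫⁻ τ, ENNReal.ofReal (τ ^ n) ∂ν =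
      ENNReal.ofReal (n.factorial / Real.Gamma (α * n + 1))) (z : ℂ) :
    mittagLeffler α (-z) = ∫ τ : ℝ, Complex.exp (-z * (τ : ℂ)) ∂ν := by
  have hΓ : ∀ n : ℕ, 0 < Real.Gamma (α * n + 1) := fun n =>
    Real.Gamma_pos_of_pos (by positivity)
  have hpow : ∀ n : ℕ, ∀ᵐ τ ∂ν, 0 ≤ τ ^ n := fun n => hν.mono fun τ hτ => pow_nonneg hτ n
  have hint : ∀ n : ℕ, Integrable (fun τ : ℝ => τ ^ n) ν := fun n => by
    refine ⟨by fun_prop, ?_⟩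
    rw [hasFiniteIntegral_iff_ofReal (hpow n), hmom]
    exact ENNReal.ofReal_lt_top
  have hval : ∀ n : ℕ, ∫ τ, τ ^ n ∂ν = n.factorial / Real.Gamma (α * n + 1) := fun n => by
    have := hΓ n
    rw [integral_eq_lintegral_of_nonneg_ae (hpow n) (by fun_prop), hmom,
      ENNReal.toReal_ofReal (by positivity)]
  have hF : ∀ n : ℕ, Integrable (fun τ : ℝ => (-z) ^ n / n.factorial * ((τ ^ n : ℝ) : ℂ)) ν :=
    fun n => (hint n).ofReal.const_mul _
  have hnorm : ∀ n : ℕ, ∫ τ : ℝ, ‖(-z) ^ n / n.factorial * ((τ ^ n : ℝ) : ℂ)‖ ∂ν =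
      ‖(-z) ^ n / (Real.Gamma (α * n + 1) : ℂ)‖ := fun n => by
    have h1 : ∫ τ : ℝ, ‖(-z) ^ n / n.factorial * ((τ ^ n : ℝ) : ℂ)‖ ∂ν =
        ∫ τ : ℝ, ‖(-z) ^ n / (n.factorial : ℂ)‖ * τ ^ n ∂ν := by
      refine integral_congr_ae ?_
      filter_upwards [hpow n] with τ hτ
      rw [norm_mul, Complex.norm_real, Real.norm_of_nonneg hτ]
    rw [h1, integral_const_mul, hval, norm_div, norm_div, Complex.norm_real,
      Real.norm_of_nonneg (hΓ n).le, Complex.norm_natCast]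
    field_simp
  have hsum := hasSum_integral_of_summable_integral_norm hF
    (by simpa only [hnorm] using (summable_mittagLeffler hα0 (-z)).norm)
  have hexp : ∀ τ : ℝ, ∑' n : ℕ, (-z) ^ n / n.factorial * ((τ ^ n : ℝ) : ℂ) =
      Complex.exp (-z * τ) := fun τ => by
    rw [Complex.exp_eq_exp_ℂ, NormedSpace.exp_eq_tsum_div]
    refine tsum_congr fun n => ?_
    rw [mul_pow]
    push_cast
    ring
  simp only [hexp] at hsum
  rw [← hsum.tsum_eq, mittagLeffler]
  refine tsum_congr fun n => ?_
  rw [integral_const_mul, integral_complex_ofReal, hval]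
  push_cast
  have : (n.factorial : ℂ) ≠ 0 := by exact_mod_cast n.factorial_ne_zero
  field_simp

/-! ### Uniqueness, existence and the representation -/

namespace IsMittagLefflerMeasure

variable {α : ℝ} {ν : Measure ℝ}

theorem ae_nonneg (h : IsMittagLefflerMeasure α ν) : ∀ᵐ τ ∂ν, 0 ≤ τ := by
  rcases h with ⟨-, f, -, rfl⟩ | ⟨-, rfl⟩
  · exact (ae_pos_stableNu α f).mono fun _ => le_of_lt
  · rw [ae_dirac_iff measurableSet_Ici]
    exact zero_le_one

theorem lintegral_pow (hα0 : 0 < α) (h : IsMittagLefflerMeasure α ν) (n : ℕ) :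
    ∫⁻ τ, ENNReal.ofReal (τ ^ n) ∂ν =
      ENNReal.ofReal (n.factorial / Real.Gamma (α * n + 1)) := by
  rcases h with ⟨-, f, hf, rfl⟩ | ⟨rfl, rfl⟩
  · exact lintegral_pow_stableNu hα0 hf n
  · have : (n.factorial : ℝ) ≠ 0 := by exact_mod_cast n.factorial_ne_zero
    rw [lintegral_dirac' _ (by fun_prop), one_mul, Real.Gamma_nat_eq_factorial, div_self this,
      one_pow]

theorem isProbabilityMeasure (hα0 : 0 < α) (h : IsMittagLefflerMeasure α ν) :
    IsProbabilityMeasure ν :=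
  ⟨by simpa using h.lintegral_pow hα0 0⟩

theorem unique (hα0 : 0 < α) {ν' : Measure ℝ} (h : IsMittagLefflerMeasure α ν)
    (h' : IsMittagLefflerMeasure α ν') : ν = ν' := by
  have := h.isProbabilityMeasure hα0
  have := h'.isProbabilityMeasure hα0
  refine Measure.ext_of_charFun (funext fun t => ?_)
  -- The characteristic function at `t` is the representation at `z = -(t * I)`, a value depending
  -- on `α` alone.
  have e : ∀ x : ℝ, (t : ℂ) * x * Complex.I = -(-(t * Complex.I)) * x := fun x => by ring
  simp only [charFun_apply_real, e]
  rw [← mittagLeffler_neg_eq_integral hα0 h.ae_nonneg (h.lintegral_pow hα0),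
    ← mittagLeffler_neg_eq_integral hα0 h'.ae_nonneg (h'.lintegral_pow hα0)]

end IsMittagLefflerMeasure

theorem exists_isMittagLefflerMeasure {α : ℝ} (hα0 : 0 < α) (hα1 : α ≤ 1) :
    ∃ ν : Measure ℝ, IsMittagLefflerMeasure α ν := by
  rcases hα1.lt_or_eq with h | h
  · obtain ⟨f, hf⟩ := exists_isOneSidedStableDensity hα0 h
    exact ⟨_, Or.inl ⟨h, f, hf, rfl⟩⟩
  · exact ⟨_, Or.inr ⟨h, rfl⟩⟩

theorem lemmaA (α : ℝ) (hα0 : 0 < α) (hα1 : α ≤ 1) :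
    (∃! ν : Measure ℝ, IsMittagLefflerMeasure α ν) ∧
    ∀ ν : Measure ℝ, IsMittagLefflerMeasure α ν →
      IsProbabilityMeasure ν ∧ ν (Set.Iio 0) = 0 ∧
      ∀ z : ℂ, 0 ≤ z.re →
        Summable (fun n : ℕ => (-z) ^ n / (Real.Gamma (α * n + 1) : ℂ)) ∧
        IntegrableOn (fun τ : ℝ => Complex.exp (-z * (τ : ℂ))) (Set.Ici 0) ν ∧
        mittagLeffler α (-z) = ∫ τ in Set.Ici (0 : ℝ), Complex.exp (-z * (τ : ℂ)) ∂ν := by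
  refine ⟨?_, fun ν hν => ?_⟩
  · obtain ⟨ν, hν⟩ := exists_isMittagLefflerMeasure hα0 hα1
    exact ⟨ν, hν, fun ν' hν' => hν'.unique hα0 hν⟩
  · have hprob := hν.isProbabilityMeasure hα0
    have hres : ν.restrict (Set.Ici 0) = ν := Measure.restrict_eq_self_of_ae_mem hν.ae_nonneg
    refine ⟨hprob, ?_, fun z hz => ⟨summable_mittagLeffler hα0 (-z), ?_, ?_⟩⟩
    · have h := hν.ae_nonneg
      simp only [ae_iff, not_le] at h
      exact h
    · refine Measure.integrableOn_of_bounded (M := 1) (measure_ne_top _ _)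
        (by fun_prop) ?_
      filter_upwards [ae_restrict_mem measurableSet_Ici] with τ hτ
      rw [Complex.norm_exp, Real.exp_le_one_iff]
      simpa using mul_nonneg hz hτ
    · rw [hres, mittagLeffler_neg_eq_integral hα0 hν.ae_nonneg (hν.lintegral_pow hα0)]
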